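/- For $a,b\in\mathbb R$ let $E_a f(x)=e^{2\pi i a x}f(x)$ and $T_b f(x)=f(x-b)$ on $L^2(\mathbb R)$, and write $\pi_U$ for the orthogonal projection onto a closed subspace $U$. For a finite family $\mathbf W=(W_i)_{0\le i\le N-1}$ of closed subspaces of $\mathcal H=L^2(\mathbb R)$, $(\mathbf W,1)$ is a *fusion frame* if there are $0<\alpha\le\beta<\infty$ with $\alpha\|f\|^2\le\sum_i\|\pi_{W_i}f\|^2\le\beta\|f\|^2$ for all $f\in\mathcal H$; it is *$\alpha$-tight* if $\sum_i\|\pi_{W_i}f\|^2=\alpha\|f\|^2$ for all $f$. It is a *harmonic fusion frame* if moreover, for some unitary operator $U$, $W_{i+1}=UW_i$ for $0\le i\le N-2$ and $W_0=UW_{N-1}$. Its synthesis operator $T_{\mathbf W}:\bigoplus_iW_i\to\mathcal H$ is $(f_i)_i\mapsto\sum_i f_i$, with adjoint $T_{\mathbf W}^*f=(\pi_{W_i}f)_i$, and $S_{\mathbf W}=T_{\mathbf W}T_{\mathbf W}^*$. If $(\mathbf W,1)$ and $(\mathbf V,1)$ are fusion frames, $(\mathbf V,1)$ is a *($Q$-)dual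 fusion frame* of $(\mathbf W,1)$ if there is a bounded linear $Q:\bigoplus_iW_i\to\bigoplus_iV_i$ with $T_{\mathbf V}QT_{\mathbf W}^*=I_{\mathcal H}$. The *canonical dual* of $(\mathbf W,1)$ is $((S_{\mathbf W}^{-1}W_i)_i,1)$. Let $d\in\mathbb C$ and $N\in\mathbb N$ satisfy $\frac1{\sqrt2}<|d|<1$, $M:=|d|^2N\in\mathbb N$ and $M>1$. Let $c_1,\dots,c_{N-M}\in\mathbb C$, not all zero, satisfy $\sum_{i=1}^{N-M}c_i=0$. Put $$g=d\,\chi_{[0,1)},\qquad h=d\,\chi_{[0,1)}+\sum_{i=1}^{N-M}c_i\,\chi_{[1+\frac{i-1}{M},\,1+\frac iM)},$$ and, for $0\le i\le N-1$, $$W_i=\overline{\operatorname{span}}\{E_{|d|^2(Nm+i)}T_ng\}_{m,n\in\mathbb Z},\qquad V_i=\overline{\operatorname{span}}\{E_{|d|^2(Nm+i)}T_nh\}_{m,n\in\mathbb Z}.$$ Then: 1. $\{E_{|d|^2m}T_ng\}_{m,n\in\mathbb Z}$ is a Parseval frame for $L^2(\mathbb R)$, i.e. $\sum_{m,n}|\langle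 f,E_{|d|^2m}T_ng\rangle|^2=\|f\|^2$ for all $f$. 2. $(\mathbf W,1)$ and $(\mathbf V,1)$ are harmonic fusion frames, both with the unitary operator $E_{|d|^2}$, and $(\mathbf W,1)$ is $|d|^{-2}$-tight. 3. $(\mathbf V,1)$ is a dual fusion frame of $(\mathbf W,1)$; more precisely, it is a $Q$-dual fusion frame for the bounded operator $Q\{f_i\}_i=\big\{\sum_{m,n\in\mathbb Z}\langle f_i,E_{|d|^2(Nm+i)}T_ng\rangle\,E_{|d|^2(Nm+i)}T_nh\big\}_i$. 4. $(\mathbf W,1)$ coincides with its canonical dual, and $V_i\ne W_i$ for every $0\le i\le N-1$. Hence $(\mathbf V,1)$ is not the canonical dual of $(\mathbf W,1)$: $V_i\neq S_{\mathbf W}^{-1}W_i$ for every $i$. -/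

import Mathlib

open MeasureTheory

noncomputable section

namespace FusionFrame

section General

variable {H : Type*} [NormedAddCommGroup H] [InnerProductSpace ℂ H]

/-- A frame for `H` with both frame bounds equal to one. Mathlib's inner product is linear in its
second variable, so `inner ℂ (e k) f` is the usual coefficient of `f` at `e k`. -/
def IsParsevalFrame {κ : Type*} (e : κ → H) : Prop :=
  ∀ f : H, HasSum (fun k => ‖inner ℂ (e k) f‖ ^ 2) (‖f‖ ^ 2)

variable {ι : Type*} [Fintype ι]

/-- The finite family of closed subspaces `W i` with weights `w i > 0` is a fusion frame. -/
def IsFusionFrame (W : ι → Submodule ℂ H) [∀ i, (W i).HasOrthogonalProjection]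
    (w : ι → ℝ) : Prop :=
  (∀ i, 0 < w i) ∧ ∃ α β : ℝ, 0 < α ∧ α ≤ β ∧ ∀ f : H,
    α * ‖f‖ ^ 2 ≤ ∑ i, w i ^ 2 * ‖(W i).orthogonalProjectionOnto f‖ ^ 2 ∧
    ∑ i, w i ^ 2 * ‖(W i).orthogonalProjectionOnto f‖ ^ 2 ≤ β * ‖f‖ ^ 2

/-- The family `(W, w)` is an `α`-tight fusion frame. -/
def IsTightFusionFrame (W : ι → Submodule ℂ H) [∀ i, (W i).HasOrthogonalProjection]
    (w : ι → ℝ) (α : ℝ) : Prop :=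
  (∀ i, 0 < w i) ∧ 0 < α ∧ ∀ f : H,
    ∑ i, w i ^ 2 * ‖(W i).orthogonalProjectionOnto f‖ ^ 2 = α * ‖f‖ ^ 2

/-- The Hilbert direct sum of the finitely many subspaces `W i`. -/
abbrev DirSum (W : ι → Submodule ℂ H) : Type _ := PiLp 2 (fun i => W i)

/-- The synthesis operator `(f i) ↦ ∑ i, w i • f i`. -/
def synthesis (W : ι → Submodule ℂ H) (w : ι → ℝ) : DirSum W →L[ℂ] H :=
  ∑ i, (w i : ℂ) • ((W i).subtypeL ∘L PiLp.proj 2 (𝕜 := ℂ) (fun i => W i) i)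

/-- The analysis operator `f ↦ (w i • π_{W i} f)`. -/
def analysis (W : ι → Submodule ℂ H) [∀ i, (W i).HasOrthogonalProjection]
    (w : ι → ℝ) : H →L[ℂ] DirSum W :=
  (PiLp.continuousLinearEquiv 2 ℂ (fun i => W i)).symm.toContinuousLinearMap ∘L
    ContinuousLinearMap.pi (fun i => (w i : ℂ) • (W i).orthogonalProjectionOnto)

/-- The fusion frame operator `S_{W,w} = T_{W,w} T_{W,w}^*`. -/
def fusionFrameOperator (W : ι → Submodule ℂ H) [∀ i, (W i).HasOrthogonalProjection]
    (w : ι → ℝ) : H →L[ℂ] H :=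
  synthesis W w ∘L analysis W w

/-- The subspaces `S_{W,w}⁻¹ (W i)` of the canonical dual of a fusion frame `(W, w)`
(for a fusion frame `S_{W,w}` is invertible). -/
def canonicalDual (W : ι → Submodule ℂ H) [∀ i, (W i).HasOrthogonalProjection]
    (w : ι → ℝ) (i : ι) : Submodule ℂ H :=
  (W i).map ((fusionFrameOperator W w).inverse : H →ₗ[ℂ] H)

/-- `(V, v)` is a `Q`-dual fusion frame of `(W, w)`. -/
def IsQDualFusionFrame (V : ι → Submodule ℂ H) [∀ i, (V i).HasOrthogonalProjection] (v : ι → ℝ)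
    (W : ι → Submodule ℂ H) [∀ i, (W i).HasOrthogonalProjection] (w : ι → ℝ)
    (Q : DirSum W →L[ℂ] DirSum V) : Prop :=
  IsFusionFrame W w ∧ IsFusionFrame V v ∧
    synthesis V v ∘L Q ∘L analysis W w = ContinuousLinearMap.id ℂ H

/-- `(V, v)` is a dual fusion frame of `(W, w)`. -/
def IsDualFusionFrame (V : ι → Submodule ℂ H) [∀ i, (V i).HasOrthogonalProjection] (v : ι → ℝ)
    (W : ι → Submodule ℂ H) [∀ i, (W i).HasOrthogonalProjection] (w : ι → ℝ) : Prop :=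
  ∃ Q : DirSum W →L[ℂ] DirSum V, IsQDualFusionFrame V v W w Q

/-- `(W, 1)` is a finite harmonic fusion frame with respect to the unitary operator `U`: it is a
fusion frame, `W (i + 1) = U (W i)` for `i + 1 < N`, and `W 0 = U (W (N - 1))`. -/
def IsHarmonicFusionFrame {N : ℕ} (U : H ≃ₗᵢ[ℂ] H) (W : Fin N → Submodule ℂ H)
    [∀ i, (W i).HasOrthogonalProjection] : Prop :=
  IsFusionFrame W (fun _ => 1) ∧
    ∀ i : Fin N, W (finRotate N i) = (W i).map (U.toLinearEquiv : H →ₗ[ℂ] H)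

end General

section Gabor

/-- The complex Hilbert space `L²(ℝ)`. -/
abbrev L2 : Type := Lp ℂ 2 (volume : Measure ℝ)

/-- The character `x ↦ e^{2πiax}`. -/
def character (a x : ℝ) : ℂ := Complex.exp (2 * Real.pi * Complex.I * a * x)

theorem norm_character (a x : ℝ) : ‖character a x‖ = 1 := by
  have h : (2 * Real.pi * Complex.I * a * x : ℂ) = ((2 * Real.pi * a * x : ℝ) : ℂ) * Complex.I := by
    push_cast; ring
  rw [character, h, Complex.norm_exp_ofReal_mul_I]

theorem character_neg_mul (a x : ℝ) : character (-a) x * character a x = 1 := by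
  rw [character, character, ← Complex.exp_add, Complex.exp_eq_one_iff]
  exact ⟨0, by push_cast; ring⟩

theorem memLp_character_mul (a : ℝ) (f : L2) :
    MemLp (fun x => character a x * f x) 2 (volume : Measure ℝ) := by
  have hc : Continuous (character a) := by unfold character; fun_prop
  refine (Lp.memLp f).of_le (hc.aestronglyMeasurable.mul (Lp.aestronglyMeasurable f)) ?_
  filter_upwards with x
  simp [norm_character]

/-- The function `character a * f` as an element of `L²(ℝ)`. -/
def modulationFun (a : ℝ) (f : L2) : L2 := (memLp_character_mul a f).toLp _

theorem coeFn_modulationFun (a : ℝ) (f : L2) :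
    modulationFun a f =ᵐ[volume] fun x => character a x * f x :=
  MemLp.coeFn_toLp _

theorem modulationFun_neg (a : ℝ) (f : L2) : modulationFun (-a) (modulationFun a f) = f := by
  apply Lp.ext
  filter_upwards [coeFn_modulationFun (-a) (modulationFun a f), coeFn_modulationFun a f]
    with x h1 h2
  rw [h1, h2, ← mul_assoc, character_neg_mul, one_mul]

/-- The modulation `E_a f (x) = e^{2πiax} f(x)`, a unitary operator on `L²(ℝ)`. -/
def modulation (a : ℝ) : L2 ≃ₗᵢ[ℂ] L2 where
  toFun := modulationFun a
  invFun := modulationFun (-a)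
  map_add' f g := by
    apply Lp.ext
    filter_upwards [coeFn_modulationFun a (f + g), coeFn_modulationFun a f,
      coeFn_modulationFun a g, Lp.coeFn_add f g,
      Lp.coeFn_add (modulationFun a f) (modulationFun a g)] with x h1 h2 h3 h4 h5
    rw [h1, h4, h5, Pi.add_apply, Pi.add_apply, h2, h3, mul_add]
  map_smul' c f := by
    apply Lp.ext
    filter_upwards [coeFn_modulationFun a (c • f), coeFn_modulationFun a f,
      Lp.coeFn_smul c f, Lp.coeFn_smul c (modulationFun a f)] with x h1 h2 h3 h4
    simp only [RingHom.id_apply]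
    rw [h1, h3, h4, Pi.smul_apply, Pi.smul_apply, h2, smul_eq_mul, smul_eq_mul]
    ring
  left_inv := modulationFun_neg a
  right_inv f := by simpa using modulationFun_neg (-a) f
  norm_map' f := by
    change ‖modulationFun a f‖ = ‖f‖
    rw [Lp.norm_def, Lp.norm_def]
    congr 1
    refine eLpNorm_congr_norm_ae ?_
    filter_upwards [coeFn_modulationFun a f] with x h
    rw [h, norm_mul, norm_character, one_mul]

/-- The translation `T_b f (x) = f (x - b)` on `L²(ℝ)`. -/
def translation (b : ℝ) : L2 →ₗᵢ[ℂ] L2 :=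
  Lp.compMeasurePreservingₗᵢ ℂ (fun x : ℝ => x - b) (measurePreserving_sub_right volume b)

/-- The Gabor system `{E_{am} T_n g}` with `m, n ∈ ℤ`. -/
def gabor (a : ℝ) (g : L2) (p : ℤ × ℤ) : L2 :=
  modulation (a * p.1) (translation p.2 g)

/-- The subsystem `{E_{a(Nm+i)} T_n g}` with `m, n ∈ ℤ` of the Gabor system. -/
def gaborSub (N : ℕ) (a : ℝ) (g : L2) (i : Fin N) (p : ℤ × ℤ) : L2 :=
  modulation (a * (N * p.1 + (i : ℕ))) (translation p.2 g)

/-- The closed span of `{E_{a(Nm+i)} T_n g}` with `m, n ∈ ℤ`. -/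
def gaborSpace (N : ℕ) (a : ℝ) (g : L2) (i : Fin N) : Submodule ℂ L2 :=
  (Submodule.span ℂ (Set.range (gaborSub N a g i))).topologicalClosure

instance gaborSpace_hasOrthogonalProjection (N : ℕ) (a : ℝ) (g : L2) (i : Fin N) :
    (gaborSpace N a g i).HasOrthogonalProjection := by
  unfold gaborSpace; infer_instance

/-- The element `z χ_{[s,t)}` of `L²(ℝ)`. -/
def step (s t : ℝ) (z : ℂ) : L2 :=
  indicatorConstLp 2 (measurableSet_Ico (a := s) (b := t)) measure_Ico_lt_top.ne z

/-- The window `d χ_{[0,1)} + ∑_{i=1}^{K} c_i χ_{[1+(i-1)/M, 1+i/M)}`. -/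
def perturbedWindow (d : ℂ) (M K : ℕ) (c : ℕ → ℂ) : L2 :=
  step 0 1 d + ∑ i ∈ Finset.Icc 1 K, step (1 + ((i : ℝ) - 1) / M) (1 + (i : ℝ) / M) (c i)

end Gabor

end FusionFrame

end

/-! Write `a = |d|²`, so `aN = M`. Two elementary facts drive the proof.

Fourier series: the characters `E_{am}` have common period `1/a > 1`, and both windows live in `[0,
1/a)`; for `h` this holds because its support ends at `1 + (N - M)/M = N/M = 1/a`. For a fixed
translation `n`, Parseval on `[n, n + 1/a)` turns the sum over `m` of products of Gabor coefficients
into `a⁻¹ ∫ g h̄ (· - n) f̄ u`. The windows overlap only on `[0,1)`, where `g h̄ = |d|² = a`, so the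
integral is that of `f̄ u` over `[n, n+1)`. Summing over `n` yields `⟪f, u⟫`. The pair `(g, g)`
gives the Parseval frame, the pair `(g, h)` the duality (`hasSum_fiber_gabor`,
`hasSum_conj_inner_gabor_mul`).

Orthogonality: inside one residue class `i` the frequencies differ by multiples of `aN = M`, and the
windows are constant on cells of length `1/M`. A nonzero multiple of `M` integrates to zero over
each cell, so inner products reduce to those of the coefficient vectors
(`inner_modulation_translation_cellSum`). Hence each subsystem of `g` is orthogonal. Since `N - M <
M`, the perturbation fits in `[1,2)`, and `∑ c_i = 0` makes its translates orthogonal to the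
subsystem of `g`. So each subsystem of `h` is orthogonal too, with squared norm increased by a
constant.

For orthogonal families of constant norm the coefficients compute the projection onto the closed
span (`hasSum_sq_norm_inner`). Regrouping the Parseval sum by residues gives tightness of `W`;
regrouping the dual sum gives `T_V Q T_W^* = I`, and this identity forces the lower bound for `V`.
Tightness makes `S_W` a scalar, so `W` is its own canonical dual; `V_i ≠ W_i` because the
perturbation is nonzero and orthogonal to `W_i`. -/

namespace FusionFrame

/-! ### Orthogonal families of constant norm, and fusion frames in Hilbert space -/

section Abstract

open scoped InnerProductSpace ENNReal

variable {H : Type*} [NormedAddCommGroup H] [InnerProductSpace ℂ H]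

theorem mem_topologicalClosure_span_of_hasSum {κ : Type*} {e : κ → H} {x : κ → ℂ} {y : H}
    (h : HasSum (fun p => x p • e p) y) :
    y ∈ (Submodule.span ℂ (Set.range e)).topologicalClosure :=
  mem_closure_of_tendsto h (Filter.Eventually.of_forall fun _ => Submodule.sum_mem _ fun p _ =>
    Submodule.smul_mem _ _ (Submodule.subset_span ⟨p, rfl⟩))

/-- An orthogonal family all of whose members have squared norm `s > 0`. -/
def IsEquinormOrthogonal {κ : Type*} (e : κ → H) (s : ℝ) : Prop :=
  0 < s ∧ (∀ p, ‖e p‖ ^ 2 = s) ∧ ∀ p q, p ≠ q → ⟪e p, e q⟫_ℂ = 0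

theorem isEquinormOrthogonal_of_inner {κ : Type*} [DecidableEq κ] {e : κ → H} {s : ℝ}
    (hs : 0 < s) (h : ∀ p q, ⟪e p, e q⟫_ℂ = if p = q then (s : ℂ) else 0) :
    IsEquinormOrthogonal e s := by
  refine ⟨hs, fun p => ?_, fun p q hpq => by rw [h, if_neg hpq]⟩
  rw [← inner_self_eq_norm_sq (𝕜 := ℂ), h, if_pos rfl]
  exact Complex.ofReal_re s

namespace IsEquinormOrthogonal

variable {κ : Type*} {e : κ → H} {s : ℝ}

theorem orthonormal_smul (he : IsEquinormOrthogonal e s) :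
    Orthonormal ℂ (fun p => ((Real.sqrt s : ℂ))⁻¹ • e p) := by
  obtain ⟨hs, hn, ho⟩ := he
  have hs' : 0 < Real.sqrt s := Real.sqrt_pos.2 hs
  refine ⟨fun p => ?_, fun p q hpq => ?_⟩
  · have : ‖e p‖ = Real.sqrt s := by rw [← hn p, Real.sqrt_sq (norm_nonneg _)]
    rw [norm_smul, this, norm_inv, Complex.norm_real, Real.norm_of_nonneg hs'.le,
      inv_mul_cancel₀ hs'.ne']
  · change ⟪((Real.sqrt s : ℂ))⁻¹ • e p, ((Real.sqrt s : ℂ))⁻¹ • e q⟫_ℂ = 0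
    rw [inner_smul_left, inner_smul_right, ho p q hpq, mul_zero, mul_zero]

variable [CompleteSpace H]

/-- After division by `√s` the family is orthonormal, so its synthesis map is `√s` times an isometry
of `ℓ²`. -/
theorem exists_synthesis (he : IsEquinormOrthogonal e s) :
    ∃ L : lp (fun _ : κ => ℂ) 2 →L[ℂ] H,
      (∀ x, HasSum (fun p => x p • e p) (L x)) ∧
      (∀ f p, (ContinuousLinearMap.adjoint L f) p = ⟪e p, f⟫_ℂ) ∧
      ∀ x, ‖L x‖ ^ 2 = s * ‖x‖ ^ 2 := by
  classical
  have hs := he.1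
  have hs' : (Real.sqrt s : ℂ) ≠ 0 := by
    exact_mod_cast (Real.sqrt_pos.2 hs).ne'
  have hb := he.orthonormal_smul.orthogonalFamily
  let L : lp (fun _ : κ => ℂ) 2 →L[ℂ] H :=
    (Real.sqrt s : ℂ) • hb.linearIsometry.toContinuousLinearMap
  have hL : ∀ x, HasSum (fun p => x p • e p) (L x) := by
    intro x
    have h := (hb.hasSum_linearIsometry x).const_smul (Real.sqrt s : ℂ)
    refine h.congr_fun fun p => ?_
    simp only [LinearIsometry.toSpanSingleton_apply]
    rw [smul_comm, smul_inv_smul₀ hs']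
  refine ⟨L, hL, fun f p => ?_, fun x => ?_⟩
  · have h1 : L (lp.single 2 p (1 : ℂ)) = e p := by
      refine (hL _).unique ?_
      convert hasSum_single (f := fun q => (lp.single 2 p (1 : ℂ) : lp (fun _ : κ => ℂ) 2) q • e q)
        p ?_
      · simp
      · intro q hq
        simp [hq]
    rw [← h1, ← ContinuousLinearMap.adjoint_inner_right, lp.inner_single_left]
    simp
  · change ‖(Real.sqrt s : ℂ) • hb.linearIsometry x‖ ^ 2 = _
    rw [norm_smul, LinearIsometry.norm_map, Complex.norm_real, mul_pow, Real.norm_eq_abs, sq_abs,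
      Real.sq_sqrt hs.le]

/-- The projection is `s⁻¹ L L^* f`, where `L` is the synthesis map; since `L` scales norms by `√s`,
the coefficient sequence `L^* f` has squared norm `s` times that of the projection. -/
theorem hasSum_sq_norm_inner (he : IsEquinormOrthogonal e s) (f : H) :
    HasSum (fun p => ‖⟪e p, f⟫_ℂ‖ ^ 2) (s * ‖(Submodule.span ℂ
      (Set.range e)).topologicalClosure.orthogonalProjectionOnto f‖ ^ 2) := by
  obtain ⟨L, hL, hA, hn⟩ := he.exists_synthesis
  have hs := he.1
  have hs' : (s : ℂ) ≠ 0 := by exact_mod_cast hs.ne'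
  set W := (Submodule.span ℂ (Set.range e)).topologicalClosure with hW
  have hmem : ∀ x, L x ∈ W := fun x => mem_topologicalClosure_span_of_hasSum (hL x)
  have hproj : (W.orthogonalProjectionOnto f : H) =
      (s : ℂ)⁻¹ • L (ContinuousLinearMap.adjoint L f) := by
    rw [Submodule.coe_orthogonalProjectionOnto_apply]
    refine Submodule.eq_starProjection_of_mem_orthogonal (W.smul_mem _ (hmem _)) ?_
    rw [hW, Submodule.orthogonal_closure, Submodule.mem_orthogonal]
    intro w hw
    induction hw using Submodule.span_induction with
    | mem w hw =>
      obtain ⟨p, rfl⟩ := hw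
      have h1 : ⟪e p, L (ContinuousLinearMap.adjoint L f)⟫_ℂ = s * ⟪e p, f⟫_ℂ := by
        have h2 := (hL (ContinuousLinearMap.adjoint L f)).mapL (innerSL ℂ (e p))
        refine h2.unique ?_
        simp only [innerSL_apply_apply, inner_smul_right, hA]
        convert hasSum_single p ?_ using 1
        · rw [inner_self_eq_norm_sq_to_K, mul_comm, ← he.2.1 p]
          push_cast
          rfl
        · intro q hq
          rw [he.2.2 p q hq.symm, mul_zero]
      rw [inner_sub_right, inner_smul_right, h1, inv_mul_cancel_left₀ hs', sub_self]
    | zero => simp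
    | add x y _ _ hx hy => rw [inner_add_left, hx, hy, add_zero]
    | smul c x _ hx => rw [inner_smul_left, hx, mul_zero]
  have h2 : s * ‖W.orthogonalProjectionOnto f‖ ^ 2 = ‖ContinuousLinearMap.adjoint L f‖ ^ 2 := by
    rw [← Submodule.norm_coe, hproj, norm_smul, mul_pow, hn, norm_inv, Complex.norm_real,
      Real.norm_of_nonneg hs.le]
    field_simp
  rw [h2]
  have h3 := lp.hasSum_norm (p := 2) (by simp) (ContinuousLinearMap.adjoint L f)
  simp only [ENNReal.toReal_ofNat, hA] at h3
  exact_mod_cast h3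

theorem exists_frameOperator {e' : κ → H} {s' : ℝ} (he : IsEquinormOrthogonal e s)
    (he' : IsEquinormOrthogonal e' s') :
    ∃ Q : H →L[ℂ] (Submodule.span ℂ (Set.range e')).topologicalClosure,
      ∀ f, HasSum (fun p => ⟪e p, f⟫_ℂ • e' p) (Q f : H) := by
  obtain ⟨L, hL, hA, hn⟩ := he.exists_synthesis
  obtain ⟨L', hL', hA', hn'⟩ := he'.exists_synthesis
  set W := (Submodule.span ℂ (Set.range e')).topologicalClosure with hW
  have hmem : ∀ x, L' x ∈ W := fun x => mem_topologicalClosure_span_of_hasSum (hL' x)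
  refine ⟨(L' ∘L ContinuousLinearMap.adjoint L).codRestrict W fun x => hmem _, fun f => ?_⟩
  have := hL' (ContinuousLinearMap.adjoint L f)
  simp only [hA] at this
  exact this

end IsEquinormOrthogonal

variable {ι : Type*} [Fintype ι] (W : ι → Submodule ℂ H)

theorem synthesis_one_apply (F : DirSum W) : synthesis W (fun _ => 1) F = ∑ i, (F i : H) := by
  simp [synthesis]

variable [∀ i, (W i).HasOrthogonalProjection]

theorem IsTightFusionFrame.isFusionFrame {W : ι → Submodule ℂ H}
    [∀ i, (W i).HasOrthogonalProjection] {w : ι → ℝ} {α : ℝ} (h : IsTightFusionFrame W w α) :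
    IsFusionFrame W w :=
  ⟨h.1, α, α, h.2.1, le_rfl, fun f => ⟨(h.2.2 f).ge, (h.2.2 f).le⟩⟩

theorem analysis_one_apply {ι : Type*} (W : ι → Submodule ℂ H)
    [∀ i, (W i).HasOrthogonalProjection] (f : H) (i : ι) :
    analysis W (fun _ => 1) f i = (W i).orthogonalProjectionOnto f := by
  simp [analysis]

theorem norm_sq_analysis_one (f : H) :
    ‖analysis W (fun _ => 1) f‖ ^ 2 = ∑ i, ‖(W i).orthogonalProjectionOnto f‖ ^ 2 := by
  rw [PiLp.norm_sq_eq_of_L2]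
  simp only [analysis_one_apply]

theorem inner_synthesis_one (f : H) (F : DirSum W) :
    ⟪f, synthesis W (fun _ => 1) F⟫_ℂ = ⟪analysis W (fun _ => 1) f, F⟫_ℂ := by
  rw [synthesis_one_apply, inner_sum, PiLp.inner_apply]
  refine Finset.sum_congr rfl fun i _ => ?_
  rw [analysis_one_apply, Submodule.inner_orthogonalProjectionOnto_eq_of_mem_right]

/-- On a complex space an operator is determined by its quadratic form, and tightness says that the
form of `S_W` is `α‖f‖²`. -/
theorem fusionFrameOperator_eq_smul {α : ℝ} (h : IsTightFusionFrame W (fun _ => 1) α) :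
    fusionFrameOperator W (fun _ => 1) = (α : ℂ) • ContinuousLinearMap.id ℂ H := by
  apply ContinuousLinearMap.coe_injective
  rw [← ext_inner_map]
  intro f
  simp only [ContinuousLinearMap.coe_coe]
  have h2 := h.2.2 f
  simp only [one_pow, one_mul] at h2
  rw [← norm_sq_analysis_one] at h2
  have h3 : ⟪f, fusionFrameOperator W (fun _ => 1) f⟫_ℂ = (α * ‖f‖ ^ 2 : ℝ) := by
    rw [fusionFrameOperator, ContinuousLinearMap.comp_apply, inner_synthesis_one,
      inner_self_eq_norm_sq_to_K, ← h2]
    simp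
  rw [← inner_conj_symm, h3, Complex.conj_ofReal]
  change _ = ⟪(α : ℂ) • f, f⟫_ℂ
  rw [inner_smul_left, inner_self_eq_norm_sq_to_K]
  simp

theorem canonicalDual_eq_self {α : ℝ} (h : IsTightFusionFrame W (fun _ => 1) α) :
    canonicalDual W (fun _ => 1) = W := by
  have hα : (α : ℂ) ≠ 0 := by exact_mod_cast h.2.1.ne'
  have hinv : (fusionFrameOperator W (fun _ => 1)).inverse =
      (α : ℂ)⁻¹ • ContinuousLinearMap.id ℂ H := by
    rw [fusionFrameOperator_eq_smul W h]
    refine ContinuousLinearMap.inverse_eq ?_ ?_ <;> ext f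
    · exact smul_inv_smul₀ hα f
    · exact inv_smul_smul₀ hα f
  funext i
  rw [canonicalDual, hinv]
  have : (((α : ℂ)⁻¹ • ContinuousLinearMap.id ℂ H : H →L[ℂ] H) : H →ₗ[ℂ] H) =
      (α : ℂ)⁻¹ • LinearMap.id := rfl
  rw [this, Submodule.map_smul _ _ _ (inv_ne_zero hα), Submodule.map_id]

/-- With `R = Q T_W^*`, the identity `T_V R = I` gives `‖f‖² = ⟪T_V^* f, R f⟫ ≤ ‖T_V^* f‖ ‖R‖ ‖f‖`,
which is the lower bound. The upper bound holds for any finite family, as projections are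
contractions. -/
theorem isFusionFrame_of_dual {V : ι → Submodule ℂ H} [∀ i, (V i).HasOrthogonalProjection]
    (Q : DirSum W →L[ℂ] DirSum V)
    (hQ : synthesis V (fun _ => 1) ∘L Q ∘L analysis W (fun _ => 1) =
      ContinuousLinearMap.id ℂ H) : IsFusionFrame V (fun _ => 1) := by
  set R := Q ∘L analysis W (fun _ => 1) with hR
  -- The summand 1 keeps `C` positive even if `R = 0`. Below, adding `C⁻¹` to the number of
  -- subspaces makes the comparison of the two bounds immediate.
  set C : ℝ := ‖R‖ ^ 2 + 1 with hC
  have hC0 : 0 < C := by positivity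
  refine ⟨fun _ => one_pos, C⁻¹, C⁻¹ + Fintype.card ι, inv_pos.2 hC0, by simp, fun f => ?_⟩
  simp only [one_pow, one_mul]
  constructor
  · rw [← norm_sq_analysis_one]
    set A := analysis V (fun _ => 1) f with hA
    have h1 : ‖f‖ ^ 2 ≤ ‖A‖ * (‖R‖ * ‖f‖) := by
      have h2 : ⟪f, f⟫_ℂ = ⟪A, R f⟫_ℂ := by
        rw [hA, ← inner_synthesis_one]
        congr 1
        exact (congrArg (fun S : H →L[ℂ] H => S f) hQ).symm
      rw [inner_self_eq_norm_sq_to_K] at h2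
      have h3 : ‖f‖ ^ 2 = ‖⟪A, R f⟫_ℂ‖ := by rw [← h2]; simp
      rw [h3]
      exact (norm_inner_le_norm _ _).trans
        (mul_le_mul_of_nonneg_left (R.le_opNorm f) (norm_nonneg _))
    have h4 : ‖f‖ ≤ ‖A‖ * ‖R‖ := by
      rcases (norm_nonneg f).eq_or_lt with h0 | h0
      · rw [← h0]; positivity
      · nlinarith
    have h5 : ‖f‖ ^ 2 ≤ (‖A‖ * ‖R‖) ^ 2 := pow_le_pow_left₀ (norm_nonneg _) h4 2
    rw [inv_mul_le_iff₀ hC0]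
    nlinarith [sq_nonneg ‖A‖]
  · calc ∑ i, ‖(V i).orthogonalProjectionOnto f‖ ^ 2 ≤ ∑ _i : ι, ‖f‖ ^ 2 :=
          Finset.sum_le_sum fun i _ => pow_le_pow_left₀ (norm_nonneg _)
            (Submodule.norm_orthogonalProjectionOnto_apply_le _ _) 2
      _ = Fintype.card ι * ‖f‖ ^ 2 := by simp
      _ ≤ _ := by
        have := mul_nonneg (inv_pos.2 hC0).le (sq_nonneg ‖f‖)
        linarith

end Abstract

end FusionFrame

namespace FusionFrame

/-! ### Parseval's identity on one period, applied to modulated translates -/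

section Fourier

open scoped InnerProductSpace ComplexConjugate
open Set

/-- Parseval's identity on the circle, for two functions. -/
theorem hasSum_conj_fourierCoeff_mul {T : ℝ} [hT : Fact (0 < T)]
    (f g : Lp ℂ 2 (AddCircle.haarAddCircle (T := T))) :
    HasSum (fun m => conj (fourierCoeff f m) * fourierCoeff g m)
      (∫ t : AddCircle T, conj (f t) * g t ∂AddCircle.haarAddCircle) := by
  have h := fourierBasis.hasSum_inner_mul_inner f g
  rw [L2.inner_def] at h
  simp only [RCLike.inner_apply'] at h
  refine h.congr_fun fun m => ?_
  rw [← fourierBasis_repr, ← fourierBasis_repr, HilbertBasis.repr_apply_apply,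
    HilbertBasis.repr_apply_apply, inner_conj_symm]

theorem hasSum_conj_fourierCoeffOn_mul {a b : ℝ} {f g : ℝ → ℂ} (hab : a < b)
    (hf : MemLp f 2 (volume.restrict (Ioc a b))) (hg : MemLp g 2 (volume.restrict (Ioc a b))) :
    HasSum (fun m => conj (fourierCoeffOn hab f m) * fourierCoeffOn hab g m)
      ((b - a)⁻¹ • ∫ x in a..b, conj (f x) * g x) := by
  have := Fact.mk (by linarith : 0 < b - a)
  rw [← add_sub_cancel a b] at hf hg
  have h1 := hf.memLp_liftIoc.haarAddCircle
  have h2 := hg.memLp_liftIoc.haarAddCircle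
  convert hasSum_conj_fourierCoeff_mul h1.toLp h2.toLp
  · simp [fourierCoeff_congr_ae h1.coeFn_toLp, fourierCoeff_liftIoc_eq]
  · simp [fourierCoeff_congr_ae h2.coeFn_toLp, fourierCoeff_liftIoc_eq]
  · nth_rw 2 [← add_sub_cancel a b]
    rw [← AddCircle.integral_liftIoc_eq_intervalIntegral, ← AddCircle.integral_haarAddCircle]
    apply integral_congr_ae
    filter_upwards [h1.coeFn_toLp, h2.coeFn_toLp] with x hx hy
    rw [hx, hy]
    rfl

theorem conj_character (a x : ℝ) : conj (character a x) = character (-a) x := by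
  rw [character, character, ← Complex.exp_conj]
  congr 1
  simp [Complex.conj_ofNat]

theorem character_mul_character (a b x : ℝ) :
    character a x * character b x = character (a + b) x := by
  rw [character, character, character, ← Complex.exp_add]
  congr 1
  push_cast
  ring

theorem hasSum_conj_integral_character_mul {s a : ℝ} (ha : 0 < a) {F G : ℝ → ℂ}
    (hF : MemLp F 2 (volume.restrict (Ioc s (s + a⁻¹))))
    (hG : MemLp G 2 (volume.restrict (Ioc s (s + a⁻¹)))) :
    HasSum (fun m : ℤ => conj (∫ x in Ioc s (s + a⁻¹), character (-(a * m)) x * F x) *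
        ∫ x in Ioc s (s + a⁻¹), character (-(a * m)) x * G x)
      ((a⁻¹ : ℝ) * ∫ x in Ioc s (s + a⁻¹), conj (F x) * G x) := by
  have hab : s < s + a⁻¹ := by have := inv_pos.2 ha; linarith
  have ha' : (a : ℂ) ≠ 0 := by exact_mod_cast ha.ne'
  have key : ∀ (F : ℝ → ℂ) (m : ℤ), fourierCoeffOn hab F m =
      a * ∫ x in Ioc s (s + a⁻¹), character (-(a * m)) x * F x := by
    intro F m
    rw [fourierCoeffOn_eq_integral, intervalIntegral.integral_of_le hab.le, Complex.real_smul]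
    congr 1
    · simp
    · refine integral_congr_ae (Filter.Eventually.of_forall fun x => ?_)
      simp only [smul_eq_mul, fourier_coe_apply, character]
      congr 2
      push_cast
      field_simp
      ring
  -- Each normalized Fourier coefficient carries a factor `a`, the reciprocal of the period;
  -- removing both and keeping the one in the mean of the product leaves `a⁻¹`.
  have h := (hasSum_conj_fourierCoeffOn_mul hab hF hG).mul_left ((a : ℂ)⁻¹ * (a : ℂ)⁻¹)
  rw [intervalIntegral.integral_of_le hab.le, Complex.real_smul] at h
  have e1 : ((a : ℂ)⁻¹ * (a : ℂ)⁻¹ * (((s + a⁻¹ - s)⁻¹ : ℝ) : ℂ)) = ((a⁻¹ : ℝ) : ℂ) := by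
    rw [add_sub_cancel_left, inv_inv]
    push_cast
    field_simp
  rw [← mul_assoc, e1] at h
  refine h.congr_fun fun m => ?_
  rw [key, key, map_mul, Complex.conj_ofReal]
  field_simp

theorem coeFn_modulation (α : ℝ) (f : L2) :
    modulation α f =ᵐ[volume] fun x => character α x * f x :=
  coeFn_modulationFun α f

theorem coeFn_modulation_translation {g : L2} {φ : ℝ → ℂ} (hg : g =ᵐ[volume] φ) (α b : ℝ) :
    modulation α (translation b g) =ᵐ[volume] fun x => character α x * φ (x - b) := by
  have h1 : translation b g =ᵐ[volume] fun x => g (x - b) :=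
    Lp.coeFn_compMeasurePreserving g (measurePreserving_sub_right volume b)
  have h2 : (fun x => g (x - b)) =ᵐ[volume] fun x => φ (x - b) :=
    (measurePreserving_sub_right volume b).quasiMeasurePreserving.ae_eq_comp hg
  filter_upwards [coeFn_modulation α (translation b g), h1, h2] with x e1 e2 e3
  rw [e1, e2, e3]

theorem inner_modulation_translation {g : L2} {φ : ℝ → ℂ} (hg : g =ᵐ[volume] φ) (α b : ℝ)
    (f : L2) : ⟪modulation α (translation b g), f⟫_ℂ =
      ∫ x, character (-α) x * (conj (φ (x - b)) * f x) := by
  rw [L2.inner_def]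
  refine integral_congr_ae ?_
  filter_upwards [coeFn_modulation_translation hg α b] with x hx
  rw [RCLike.inner_apply', hx, map_mul, conj_character, mul_assoc]

theorem memLp_conj_comp_sub_mul {φ : ℝ → ℂ} (hφ : Measurable φ) {C : ℝ} (hC : ∀ x, ‖φ x‖ ≤ C)
    (b : ℝ) (f : L2) : MemLp (fun x => conj (φ (x - b)) * f x) 2 (volume : Measure ℝ) := by
  refine (Lp.memLp f).of_le_mul (c := C) ?_ (Filter.Eventually.of_forall fun x => ?_)
  · exact ((Complex.continuous_conj.measurable.comp
      (hφ.comp (measurable_id.sub_const b))).aestronglyMeasurable).mul (Lp.aestronglyMeasurable f)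
  · rw [norm_mul, RCLike.norm_conj]
    exact mul_le_mul_of_nonneg_right (hC _) (norm_nonneg _)

/-- Reconciles windows on half-open intervals closed on the left with Fourier integrals over `Ioc`;
only the point `b` has to be discarded. -/
theorem ae_notMem_Ioc_imp {φ : ℝ → ℂ} {T : ℝ} (hφ : ∀ x, x ∉ Ico 0 T → φ x = 0) (b : ℝ) :
    ∀ᵐ x : ℝ, x ∉ Ioc b (b + T) → φ (x - b) = 0 := by
  have h : ∀ᵐ x : ℝ, x ≠ b := by simp [ae_iff]
  filter_upwards [h] with x hx hx'
  refine hφ _ fun hm => hx' ⟨lt_of_le_of_ne ?_ hx.symm, ?_⟩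
  · linarith [hm.1]
  · linarith [hm.2]

/-- For windows supported in one period of the characters, the two Gabor systems with a fixed
translation multiply the Fourier coefficients as in Parseval's identity. -/
theorem hasSum_inner_mul_inner_modulation_translation {a : ℝ} (ha : 0 < a) {g h : L2}
    {φ ψ : ℝ → ℂ} (hg : g =ᵐ[volume] φ) (hh : h =ᵐ[volume] ψ) (hφ : Measurable φ)
    (hψ : Measurable ψ) {C D : ℝ} (hC : ∀ x, ‖φ x‖ ≤ C) (hD : ∀ x, ‖ψ x‖ ≤ D)
    (hφ0 : ∀ x, x ∉ Ico 0 a⁻¹ → φ x = 0) (hψ0 : ∀ x, x ∉ Ico 0 a⁻¹ → ψ x = 0) (b : ℝ)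
    (f u : L2) :
    HasSum (fun m : ℤ => conj ⟪modulation (a * m) (translation b g), f⟫_ℂ *
        ⟪modulation (a * m) (translation b h), u⟫_ℂ)
      (∫ x, (a⁻¹ : ℝ) * (φ (x - b) * conj (ψ (x - b)) * (conj (f x) * u x))) := by
  have hF := memLp_conj_comp_sub_mul hφ hC b f
  have hG := memLp_conj_comp_sub_mul hψ hD b u
  have key := hasSum_conj_integral_character_mul (s := b) ha (hF.restrict _) (hG.restrict _)
  have e1 : ∀ (m : ℤ), ∫ x in Ioc b (b + a⁻¹), character (-(a * m)) x *
      (conj (φ (x - b)) * f x) = ⟪modulation (a * m) (translation b g), f⟫_ℂ := by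
    intro m
    rw [inner_modulation_translation hg]
    refine setIntegral_eq_integral_of_ae_compl_eq_zero ?_
    filter_upwards [ae_notMem_Ioc_imp hφ0 b] with x hx hx'
    simp [hx hx']
  have e2 : ∀ (m : ℤ), ∫ x in Ioc b (b + a⁻¹), character (-(a * m)) x *
      (conj (ψ (x - b)) * u x) = ⟪modulation (a * m) (translation b h), u⟫_ℂ := by
    intro m
    rw [inner_modulation_translation hh]
    refine setIntegral_eq_integral_of_ae_compl_eq_zero ?_
    filter_upwards [ae_notMem_Ioc_imp hψ0 b] with x hx hx'
    simp [hx hx']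
  simp only [e1, e2] at key
  convert key using 1
  rw [integral_const_mul]
  congr 1
  rw [setIntegral_eq_integral_of_ae_compl_eq_zero]
  · refine integral_congr_ae (Filter.Eventually.of_forall fun x => ?_)
    simp only [map_mul, Complex.conj_conj]
    ring
  · filter_upwards [ae_notMem_Ioc_imp hφ0 b] with x hx hx'
    simp [hx hx']

end Fourier

end FusionFrame

namespace FusionFrame

/-! ### Summing Gabor coefficients over modulations and translations -/

section GaborSums

open scoped InnerProductSpace ComplexConjugate
open Set

theorem integral_conj_mul_eq_inner (f u : L2) : ∫ x, conj (f x) * u x = ⟪f, u⟫_ℂ := by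
  rw [L2.inner_def]
  simp only [RCLike.inner_apply']

theorem integrable_conj_mul (f u : L2) : Integrable (fun x => conj (f x) * u x) := by
  have := L2.integrable_inner (𝕜 := ℂ) f u
  simpa only [RCLike.inner_apply'] using this

theorem hasSum_setIntegral_conj_mul (f u : L2) :
    HasSum (fun n : ℤ => ∫ x in Ico (n : ℝ) (n + 1), conj (f x) * u x) ⟪f, u⟫_ℂ := by
  have h := hasSum_integral_iUnion (μ := volume) (f := fun x => conj (f x) * u x)
    (fun n : ℤ => measurableSet_Ico (a := (n : ℝ)) (b := n + 1))
    (pairwise_disjoint_Ico_intCast ℝ) (integrable_conj_mul f u).integrableOn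
  rwa [iUnion_Ico_intCast, setIntegral_univ, integral_conj_mul_eq_inner] at h

variable {d : ℂ} {a : ℝ} {g h : L2} {ψ : ℝ → ℂ}

/-- The values of `ψ` on `[1, 1/a)` are irrelevant because the other window vanishes there; on
`[0,1)` the product of the windows is `|d|² = a`, which cancels the Parseval factor `a⁻¹`. -/
theorem hasSum_fiber_gabor (ha0 : 0 < a) (ha1 : a < 1) (ha : a = ‖d‖ ^ 2)
    (hg : g =ᵐ[volume] (Ico (0 : ℝ) 1).indicator fun _ => d) (hh : h =ᵐ[volume] ψ)
    (hψ : Measurable ψ) {D : ℝ} (hD : ∀ x, ‖ψ x‖ ≤ D) (hψ0 : ∀ x, x ∉ Ico 0 a⁻¹ → ψ x = 0)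
    (hψ1 : ∀ x ∈ Ico (0 : ℝ) 1, ψ x = d) (f u : L2) (n : ℤ) :
    HasSum (fun m : ℤ => conj ⟪gabor a g (m, n), f⟫_ℂ * ⟪gabor a h (m, n), u⟫_ℂ)
      (∫ x in Ico (n : ℝ) (n + 1), conj (f x) * u x) := by
  have hφm : Measurable ((Ico (0 : ℝ) 1).indicator fun _ => d) :=
    measurable_const.indicator measurableSet_Ico
  have hsub : ∀ x : ℝ, x ∉ Ico 0 a⁻¹ → (Ico (0 : ℝ) 1).indicator (fun _ => d) x = 0 := by
    intro x hx
    refine indicator_of_notMem (fun hx' => hx ⟨hx'.1, hx'.2.trans ?_⟩) _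
    exact (one_lt_inv₀ ha0).2 ha1
  have hC : ∀ x : ℝ, ‖(Ico (0 : ℝ) 1).indicator (fun _ => d) x‖ ≤ ‖d‖ :=
    fun x => norm_indicator_le_norm_self (fun _ => d) x
  have key := hasSum_inner_mul_inner_modulation_translation ha0 hg hh hφm hψ hC hD hsub hψ0 n f u
  convert! key using 1
  rw [← integral_indicator measurableSet_Ico]
  refine integral_congr_ae (Filter.Eventually.of_forall fun x => ?_)
  by_cases hx : x ∈ Ico (n : ℝ) (n + 1)
  · have hx' : x - n ∈ Ico (0 : ℝ) 1 := ⟨by linarith [hx.1], by linarith [hx.2]⟩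
    have h1 : d * conj d = (a : ℂ) := by
      rw [RCLike.mul_conj, ha]
      push_cast
      rfl
    have h2 : (a : ℂ) ≠ 0 := by exact_mod_cast ha0.ne'
    simp only [indicator_of_mem hx, indicator_of_mem hx', hψ1 _ hx', h1]
    push_cast
    rw [inv_mul_cancel_left₀ h2]
  · have hx' : x - n ∉ Ico (0 : ℝ) 1 := fun h => hx ⟨by linarith [h.1], by linarith [h.2]⟩
    simp only [indicator_of_notMem hx, indicator_of_notMem hx', zero_mul, mul_zero]

theorem isParsevalFrame_gabor (ha0 : 0 < a) (ha1 : a < 1) (ha : a = ‖d‖ ^ 2)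
    (hg : g =ᵐ[volume] (Ico (0 : ℝ) 1).indicator fun _ => d) :
    IsParsevalFrame (gabor a g) := by
  intro f
  have hfib : ∀ n : ℤ, HasSum (fun m : ℤ => ‖⟪gabor a g (m, n), f⟫_ℂ‖ ^ 2)
      (∫ x in Ico (n : ℝ) (n + 1), conj (f x) * f x).re := by
    intro n
    have h1 := hasSum_fiber_gabor ha0 ha1 ha hg hg (measurable_const.indicator measurableSet_Ico)
      (fun x => norm_indicator_le_norm_self (fun _ => d) x)
      (fun x hx => indicator_of_notMem (fun hx' => hx ⟨hx'.1, hx'.2.trans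
        ((one_lt_inv₀ ha0).2 ha1)⟩) _) (fun x hx => indicator_of_mem hx _) f f n
    refine (Complex.hasSum_re h1).congr_fun fun m => ?_
    rw [← Complex.normSq_eq_conj_mul_self, Complex.ofReal_re, Complex.normSq_eq_norm_sq]
  have hsum := Complex.hasSum_re (hasSum_setIntegral_conj_mul f f)
  -- The indices are swapped so that the inner sum runs over modulations, where the value of each
  -- fibre is known.
  have hnn : 0 ≤ fun p : ℤ × ℤ => ‖⟪gabor a g (p.2, p.1), f⟫_ℂ‖ ^ 2 := fun p => by positivity
  have hs : Summable fun p : ℤ × ℤ => ‖⟪gabor a g (p.2, p.1), f⟫_ℂ‖ ^ 2 := by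
    refine (summable_prod_of_nonneg hnn).2 ⟨fun n => (hfib n).summable, ?_⟩
    simp only [(hfib _).tsum_eq]
    exact hsum.summable
  have h2 := (hs.hasSum.prod_fiberwise hfib).unique hsum
  have h3 : (⟪f, f⟫_ℂ).re = ‖f‖ ^ 2 := by
    rw [inner_self_eq_norm_sq_to_K]
    norm_cast
  rw [h3] at h2
  have h4 := hs.hasSum
  rw [h2] at h4
  exact (Equiv.prodComm ℤ ℤ).hasSum_iff.1 h4

/-- The fibre sums only determine an iterated sum. Square-summability of both coefficient families
makes the double series absolutely convergent, so it may be summed fibrewise. -/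
theorem hasSum_conj_inner_gabor_mul (ha0 : 0 < a) (ha1 : a < 1) (ha : a = ‖d‖ ^ 2)
    (hg : g =ᵐ[volume] (Ico (0 : ℝ) 1).indicator fun _ => d) (hh : h =ᵐ[volume] ψ)
    (hψ : Measurable ψ) {D : ℝ} (hD : ∀ x, ‖ψ x‖ ≤ D) (hψ0 : ∀ x, x ∉ Ico 0 a⁻¹ → ψ x = 0)
    (hψ1 : ∀ x ∈ Ico (0 : ℝ) 1, ψ x = d) (f u : L2)
    (hs : Summable fun p => ‖⟪gabor a h p, u⟫_ℂ‖ ^ 2) :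
    HasSum (fun p => conj ⟪gabor a g p, f⟫_ℂ * ⟪gabor a h p, u⟫_ℂ) ⟪f, u⟫_ℂ := by
  have hsum : Summable fun p => conj ⟪gabor a g p, f⟫_ℂ * ⟪gabor a h p, u⟫_ℂ := by
    refine Summable.of_norm_bounded
      ((isParsevalFrame_gabor ha0 ha1 ha hg f).summable.add hs) fun p => ?_
    rw [norm_mul, RCLike.norm_conj]
    nlinarith [sq_nonneg (‖⟪gabor a g p, f⟫_ℂ‖ - ‖⟪gabor a h p, u⟫_ℂ‖),
      sq_nonneg (‖⟪gabor a g p, f⟫_ℂ‖), sq_nonneg ‖⟪gabor a h p, u⟫_ℂ‖]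
  have h1 := (Equiv.prodComm ℤ ℤ).hasSum_iff.2 hsum.hasSum
  have h2 := (h1.prod_fiberwise
    (hasSum_fiber_gabor ha0 ha1 ha hg hh hψ hD hψ0 hψ1 f u)).unique
    (hasSum_setIntegral_conj_mul f u)
  rw [← h2]
  exact hsum.hasSum

theorem gaborSub_eq_gabor (N : ℕ) (a : ℝ) (g : L2) (i : Fin N) (p : ℤ × ℤ) :
    gaborSub N a g i p = gabor a g (p.1 * N + (i : ℕ), p.2) := by
  rw [gaborSub, gabor]
  push_cast
  rw [mul_comm (N : ℝ)]

/-- Splitting the modulation index into its quotient and its residue modulo `N`. -/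
def residueEquiv (N : ℕ) [NeZero N] : Fin N × (ℤ × ℤ) ≃ ℤ × ℤ where
  toFun q := (q.2.1 * N + (q.1 : ℕ), q.2.2)
  invFun p := ((Int.divModEquiv N p.1).2, ((Int.divModEquiv N p.1).1, p.2))
  left_inv q := by
    have := (Int.divModEquiv N).apply_symm_apply (q.2.1, q.1)
    rw [Int.divModEquiv_symm_apply] at this
    simp only [this]
  right_inv p := by
    have := (Int.divModEquiv N).symm_apply_apply p.1
    rw [Int.divModEquiv_symm_apply] at this
    simp only [this]

theorem gabor_residueEquiv (N : ℕ) [NeZero N] (a : ℝ) (g : L2) (q : Fin N × (ℤ × ℤ)) :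
    gabor a g (residueEquiv N q) = gaborSub N a g q.1 q.2 :=
  (gaborSub_eq_gabor N a g q.1 q.2).symm

end GaborSums

end FusionFrame

namespace FusionFrame

/-! ### Step functions on the grid of mesh `1/M` -/

section Cells

open scoped InnerProductSpace ComplexConjugate
open Set

theorem coeFn_step (s t : ℝ) (z : ℂ) : step s t z =ᵐ[volume] (Ico s t).indicator fun _ => z :=
  indicatorConstLp_coeFn

theorem step_eq_smul (s t : ℝ) (z : ℂ) : step s t z = z • step s t 1 := by
  apply Lp.ext
  filter_upwards [coeFn_step s t z, coeFn_step s t 1, Lp.coeFn_smul z (step s t 1)] with x h1 h2 h3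
  rw [h1, h3, Pi.smul_apply, h2]
  by_cases hx : x ∈ Ico s t <;> simp [hx]

theorem step_add_step {s t r : ℝ} (hst : s ≤ t) (htr : t ≤ r) (z : ℂ) :
    step s t z + step t r z = step s r z := by
  apply Lp.ext
  filter_upwards [coeFn_step s t z, coeFn_step t r z, coeFn_step s r z,
    Lp.coeFn_add (step s t z) (step t r z)] with x h1 h2 h3 h4
  rw [h4, Pi.add_apply, h1, h2, h3]
  simp only [indicator_apply, mem_Ico]
  split_ifs <;> first | (simp; done) | (exfalso; grind)

/-- The indicator function of the interval `[j / M, (j + 1) / M)`. -/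
noncomputable def cell (M : ℕ) (j : ℤ) : L2 := step (j / M) ((j + 1) / M) 1

/-- Encoding cells by a floor reduces disjointness and integer translation to integer arithmetic. -/
theorem mem_Ico_cell_iff {M : ℕ} (hM : 0 < M) (j : ℤ) (x : ℝ) :
    x ∈ Ico ((j : ℝ) / M) ((j + 1) / M) ↔ ⌊x * M⌋ = j := by
  have hM' : (0 : ℝ) < M := by exact_mod_cast hM
  rw [Int.floor_eq_iff, mem_Ico, div_le_iff₀ hM', lt_div_iff₀ hM']

theorem translation_cell {M : ℕ} (hM : 0 < M) (n j : ℤ) :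
    translation n (cell M j) = cell M (j + M * n) := by
  have hM' : (M : ℝ) ≠ 0 := by exact_mod_cast hM.ne'
  -- A translation is a modulated translation of frequency 0, so the pointwise formula for the
  -- latter applies.
  have h1 := coeFn_modulation_translation (coeFn_step (j / M) ((j + 1) / M) 1) 0 n
  have h0 : modulation 0 (translation n (cell M j)) = translation n (cell M j) := by
    apply Lp.ext
    filter_upwards [coeFn_modulation 0 (translation n (cell M j))] with x hx
    rw [hx]
    simp [character]
  rw [← h0]
  apply Lp.ext
  filter_upwards [h1, coeFn_step ((j + M * n : ℤ) / M) (((j + M * n : ℤ) + 1) / M) 1] with x h2 h3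
  rw [cell, cell, h2, h3]
  have : character 0 x = 1 := by simp [character]
  rw [this, one_mul]
  have h4 : x - n ∈ Ico ((j : ℝ) / M) ((j + 1) / M) ↔
      x ∈ Ico (((j + M * n : ℤ) : ℝ) / M) (((j + M * n : ℤ) + 1) / M) := by
    rw [mem_Ico_cell_iff hM, mem_Ico_cell_iff hM]
    have : (x - n) * M = x * M - (M * n : ℤ) := by push_cast; ring
    rw [this, Int.floor_sub_intCast]
    omega
  simp only [indicator_apply, h4]

/-- A cell of length `1/M` contains a whole number of periods of a character of frequency `Mk`. -/
theorem integral_character_cell {M : ℕ} (hM : 0 < M) (j k : ℤ) :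
    ∫ x in Ico ((j : ℝ) / M) ((j + 1) / M), character (M * k) x =
      if k = 0 then (M : ℂ)⁻¹ else 0 := by
  have hM' : (0 : ℝ) < M := by exact_mod_cast hM
  have hMc : (M : ℂ) ≠ 0 := by exact_mod_cast hM.ne'
  have hle : (j : ℝ) / M ≤ (j + 1) / M := by gcongr; linarith
  rw [integral_Ico_eq_integral_Ioc, ← intervalIntegral.integral_of_le hle]
  split_ifs with hk
  · have : ∀ x, character (M * (k : ℤ)) x = 1 := fun x => by simp [character, hk]
    simp only [this, intervalIntegral.integral_const]
    rw [← sub_div, add_sub_cancel_left, Complex.real_smul]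
    simp
  · set c : ℂ := 2 * Real.pi * Complex.I * (M * k : ℝ) with hc
    have hc0 : c ≠ 0 := by
      rw [hc]
      have : (k : ℂ) ≠ 0 := by exact_mod_cast hk
      push_cast
      exact mul_ne_zero Complex.two_pi_I_ne_zero (mul_ne_zero hMc this)
    have h1 : ∀ x : ℝ, character (M * k) x = Complex.exp (c * x) := fun x => rfl
    simp only [h1]
    rw [integral_exp_mul_complex hc0]
    have h2 : c * (((j + 1) / M : ℝ) : ℂ) = c * ((j / M : ℝ) : ℂ) + k * (2 * Real.pi * Complex.I) := by
      rw [hc]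
      push_cast
      field_simp
    rw [h2, Complex.exp_add, Complex.exp_int_mul_two_pi_mul_I, mul_one, sub_self, zero_div]

theorem inner_modulation_cell {M : ℕ} (hM : 0 < M) {α β : ℝ} {k : ℤ} (hk : β - α = M * k)
    (j l : ℤ) : ⟪modulation α (cell M j), modulation β (cell M l)⟫_ℂ =
      if j = l ∧ k = 0 then (M : ℂ)⁻¹ else 0 := by
  have h1 : ⟪modulation α (cell M j), modulation β (cell M l)⟫_ℂ =
      ∫ x, (Ico ((j : ℝ) / M) ((j + 1) / M)).indicator
        (fun x => if j = l then character (M * k) x else 0) x := by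
    rw [L2.inner_def]
    refine integral_congr_ae ?_
    filter_upwards [coeFn_modulation α (cell M j), coeFn_modulation β (cell M l),
      coeFn_step (j / M) ((j + 1) / M) 1, coeFn_step (l / M) ((l + 1) / M) 1] with x h1 h2 h3 h4
    rw [RCLike.inner_apply', h1, h2, cell, cell, h3, h4]
    simp only [indicator_apply, mem_Ico_cell_iff hM]
    by_cases hj : ⌊x * M⌋ = j
    · by_cases hl : j = l
      · have : -α + β = M * k := by linarith
        simp [hj, hl, conj_character, character_mul_character, this]
      · simp [hj, hl]
    · simp [hj]
  rw [h1, integral_indicator measurableSet_Ico]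
  by_cases hl : j = l
  · simp [hl, integral_character_cell hM]
  · simp [hl]

/-- The step function on `[0, 1)` with value `u j` on `[j / M, (j + 1) / M)`. -/
noncomputable def cellSum (M : ℕ) (u : ℕ → ℂ) : L2 := ∑ j ∈ Finset.range M, u j • cell M j

theorem step_zero_one_eq_cellSum {M : ℕ} (hM : 0 < M) (z : ℂ) :
    step 0 1 z = cellSum M fun _ => z := by
  have hM' : (M : ℝ) ≠ 0 := by exact_mod_cast hM.ne'
  have key : ∀ k : ℕ, step 0 (k / M) z = ∑ j ∈ Finset.range k, z • cell M j := by
    intro k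
    induction k with
    | zero =>
      apply Lp.ext
      filter_upwards [coeFn_step 0 ((0 : ℕ) / M) z, Lp.coeFn_zero ℂ 2 (volume : Measure ℝ)]
        with x h1 h2
      rw [h1, Finset.range_zero, Finset.sum_empty, h2]
      simp
    | succ k ih =>
      rw [Finset.sum_range_succ, ← ih, cell, ← step_eq_smul]
      push_cast
      rw [step_add_step (by positivity) (by gcongr; linarith)]
  have := key M
  rwa [div_self hM'] at this

theorem inner_modulation_translation_cellSum {M : ℕ} (hM : 0 < M) {α β : ℝ} {k : ℤ}
    (hk : β - α = M * k) (n n' : ℤ) (u v : ℕ → ℂ) :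
    ⟪modulation α (translation n (cellSum M u)), modulation β (translation n' (cellSum M v))⟫_ℂ =
      if n = n' ∧ k = 0 then (M : ℂ)⁻¹ * ∑ j ∈ Finset.range M, conj (u j) * v j else 0 := by
  have hM' : (0 : ℤ) < M := by exact_mod_cast hM
  simp only [cellSum, map_sum, map_smul, translation_cell hM, sum_inner, inner_sum,
    inner_smul_left, inner_smul_right, inner_modulation_cell hM hk]
  -- Uniqueness of quotient and remainder modulo `M`: a translated cell determines both its index
  -- and its translation.
  have key : ∀ j ∈ Finset.range M, ∀ l ∈ Finset.range M,
      ((j : ℤ) + M * n = l + M * n' ↔ j = l ∧ n = n') := by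
    intro j hj l hl
    rw [Finset.mem_range] at hj hl
    constructor
    · intro h
      have h1 : (M : ℤ) * (n - n') = l - j := by linarith
      have h2 : n - n' < 1 := by
        by_contra hc
        nlinarith
      have h3 : -1 < n - n' := by
        by_contra hc
        nlinarith
      have h4 : n = n' := by omega
      subst h4
      exact ⟨by omega, rfl⟩
    · rintro ⟨rfl, rfl⟩
      rfl
  have e : ∀ l ∈ Finset.range M, (v l * ∑ j ∈ Finset.range M, conj (u j) *
      if (j : ℤ) + M * n = l + M * n' ∧ k = 0 then (M : ℂ)⁻¹ else 0) =
      if n = n' ∧ k = 0 then (M : ℂ)⁻¹ * (conj (u l) * v l) else 0 := by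
    intro l hl
    rw [Finset.sum_eq_single_of_mem l hl]
    · simp only [key l hl l hl, true_and]
      split_ifs
      · ring
      · simp
    · intro j hj hjl
      simp [key j hj l hl, hjl]
  rw [Finset.sum_congr rfl e]
  split_ifs
  · rw [Finset.mul_sum]
  · simp

end Cells

end FusionFrame

namespace FusionFrame

/-! ### The spaces generated by the residue classes of the two Gabor systems -/

section GaborSpaces

open scoped InnerProductSpace ComplexConjugate
open Set

theorem coeFn_sum_of_ae_eq {κ : Type*} (s : Finset κ) {f : κ → L2} {φ : κ → ℝ → ℂ}
    (h : ∀ i, f i =ᵐ[volume] φ i) :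
    (∑ i ∈ s, f i : L2) =ᵐ[volume] fun x => ∑ i ∈ s, φ i x := by
  classical
  induction s using Finset.induction_on with
  | empty =>
    filter_upwards [Lp.coeFn_zero ℂ 2 (volume : Measure ℝ)] with x hx
    rw [Finset.sum_empty, hx, Finset.sum_empty, Pi.zero_apply]
  | insert i s hi ih =>
    rw [Finset.sum_insert hi]
    filter_upwards [Lp.coeFn_add (f i) (∑ i ∈ s, f i), h i, ih] with x h1 h2 h3
    rw [h1, Pi.add_apply, h2, h3, Finset.sum_insert hi]

theorem exists_coeFn_perturbedWindow (d : ℂ) {M K : ℕ} (hM : 0 < M) (c : ℕ → ℂ) :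
    ∃ (ψ : ℝ → ℂ) (D : ℝ), perturbedWindow d M K c =ᵐ[volume] ψ ∧ Measurable ψ ∧
      (∀ x, ‖ψ x‖ ≤ D) ∧ (∀ x, x ∉ Ico 0 (1 + (K : ℝ) / M) → ψ x = 0) ∧
      ∀ x ∈ Ico (0 : ℝ) 1, ψ x = d := by
  have hM' : (0 : ℝ) < M := by exact_mod_cast hM
  refine ⟨fun x => (Ico (0 : ℝ) 1).indicator (fun _ => d) x + ∑ i ∈ Finset.Icc 1 K,
    (Ico (1 + ((i : ℝ) - 1) / M) (1 + (i : ℝ) / M)).indicator (fun _ => c i) x,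
    ‖d‖ + ∑ i ∈ Finset.Icc 1 K, ‖c i‖, ?_, ?_, fun x => ?_, fun x hx => ?_, fun x hx => ?_⟩
  · rw [perturbedWindow]
    filter_upwards [Lp.coeFn_add (step 0 1 d) (∑ i ∈ Finset.Icc 1 K,
      step (1 + ((i : ℝ) - 1) / M) (1 + (i : ℝ) / M) (c i)), coeFn_step 0 1 d,
      coeFn_sum_of_ae_eq (Finset.Icc 1 K) fun i : ℕ =>
        coeFn_step (1 + ((i : ℝ) - 1) / M) (1 + (i : ℝ) / M) (c i)] with x h1 h2 h3
    rw [h1, Pi.add_apply, h2, h3]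
  · exact (measurable_const.indicator measurableSet_Ico).add
      (Finset.measurable_sum _ fun i _ => measurable_const.indicator measurableSet_Ico)
  · refine (norm_add_le _ _).trans (add_le_add (norm_indicator_le_norm_self (fun _ => d) x) ?_)
    exact (norm_sum_le _ _).trans
      (Finset.sum_le_sum fun i _ => norm_indicator_le_norm_self (fun _ => c i) x)
  · have h0 : (0 : ℝ) ≤ (K : ℝ) / M := by positivity
    dsimp only
    rw [indicator_of_notMem, zero_add]
    · refine Finset.sum_eq_zero fun i hi => indicator_of_notMem (fun hx' => hx ⟨?_, ?_⟩) _
      · have h1 : (1 : ℝ) ≤ i := by exact_mod_cast (Finset.mem_Icc.1 hi).1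
        have h2 : 0 ≤ ((i : ℝ) - 1) / M := div_nonneg (by linarith) hM'.le
        linarith [hx'.1]
      · have h1 : (i : ℝ) ≤ K := by exact_mod_cast (Finset.mem_Icc.1 hi).2
        have h2 : (i : ℝ) / M ≤ K / M := by gcongr
        linarith [hx'.2]
    · exact fun hx' => hx ⟨hx'.1, by linarith [hx'.2]⟩
  · dsimp only
    rw [indicator_of_mem hx, Finset.sum_eq_zero, add_zero]
    intro i hi
    refine indicator_of_notMem (fun hx' => ?_) _
    have h1 : (1 : ℝ) ≤ i := by exact_mod_cast (Finset.mem_Icc.1 hi).1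
    have h2 : 0 ≤ ((i : ℝ) - 1) / M := div_nonneg (by linarith) hM'.le
    linarith [hx'.1, hx.2]

theorem sum_Icc_one_eq_sum_range {A : Type*} [AddCommMonoid A] (K : ℕ) (f : ℕ → A) :
    ∑ i ∈ Finset.Icc 1 K, f i = ∑ j ∈ Finset.range K, f (j + 1) := by
  rw [Finset.range_eq_Ico, Finset.sum_Ico_add' f 0 K 1]
  rfl

/-- The coefficients `c 1, …, c K`, followed by zeros. -/
def perturbationCoeff (K : ℕ) (c : ℕ → ℂ) (j : ℕ) : ℂ := if j < K then c (j + 1) else 0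

theorem sum_range_perturbationCoeff {A : Type*} [AddCommMonoid A] {M K : ℕ} (hK : K ≤ M)
    (c : ℕ → ℂ) (F : ℕ → ℂ → A) (hF : ∀ j, F j 0 = 0) :
    ∑ j ∈ Finset.range M, F j (perturbationCoeff K c j) =
      ∑ j ∈ Finset.range K, F j (c (j + 1)) := by
  rw [← Finset.sum_subset (Finset.range_mono hK)]
  · refine Finset.sum_congr rfl fun j hj => ?_
    rw [perturbationCoeff, if_pos (Finset.mem_range.1 hj)]
  · intro j _ hj
    rw [perturbationCoeff, if_neg (by simpa using hj), hF]

/-- For `K ≤ M` the perturbation lies in `[1,2)`, so it is a single unit translate of a step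
function on `[0,1)`, padded by zeros. -/
theorem perturbedWindow_eq (d : ℂ) {M K : ℕ} (hM : 0 < M) (hK : K ≤ M) (c : ℕ → ℂ) :
    perturbedWindow d M K c =
      step 0 1 d + translation (1 : ℤ) (cellSum M (perturbationCoeff K c)) := by
  have hM' : (M : ℝ) ≠ 0 := by exact_mod_cast hM.ne'
  rw [perturbedWindow, cellSum, map_sum, sum_Icc_one_eq_sum_range]
  congr 1
  simp only [map_smul, translation_cell hM]
  rw [sum_range_perturbationCoeff hK c (fun j z => z • cell M (j + M * 1)) (by simp)]
  refine Finset.sum_congr rfl fun j _ => ?_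
  rw [step_eq_smul, cell]
  congr 2 <;> (push_cast; field_simp; ring)

theorem translation_translation_cellSum {M : ℕ} (hM : 0 < M) (n l : ℤ) (u : ℕ → ℂ) :
    translation n (translation l (cellSum M u)) = translation (n + l : ℤ) (cellSum M u) := by
  simp only [cellSum, map_sum, map_smul, translation_cell hM]
  refine Finset.sum_congr rfl fun j _ => ?_
  congr 2
  ring

section Orthogonality

variable {N M : ℕ} {a : ℝ} {d : ℂ}

theorem inner_gabor_cellSum (hM : 0 < M) (haN : a * N = M) (i : ℕ) (u v : ℕ → ℂ)
    (m n m' n' : ℤ) :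
    ⟪modulation (a * (N * m + i)) (translation n (cellSum M u)),
      modulation (a * (N * m' + i)) (translation n' (cellSum M v))⟫_ℂ =
      if n = n' ∧ m = m' then (M : ℂ)⁻¹ * ∑ j ∈ Finset.range M, conj (u j) * v j else 0 := by
  have hk : a * (N * m' + i) - a * (N * m + i) = M * ((m' - m : ℤ) : ℝ) := by
    rw [← haN]
    push_cast
    ring
  rw [inner_modulation_translation_cellSum hM hk]
  simp only [sub_eq_zero, eq_comm]

theorem inner_gaborSub_step (hM : 0 < M) (haN : a * N = M) (ha : a = ‖d‖ ^ 2) (i : Fin N)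
    (p q : ℤ × ℤ) : ⟪gaborSub N a (step 0 1 d) i p, gaborSub N a (step 0 1 d) i q⟫_ℂ =
      if p = q then (a : ℂ) else 0 := by
  have hM' : (M : ℂ) ≠ 0 := by exact_mod_cast hM.ne'
  rw [gaborSub, gaborSub, step_zero_one_eq_cellSum hM, inner_gabor_cellSum hM haN]
  have : p = q ↔ p.2 = q.2 ∧ p.1 = q.1 := by rw [Prod.ext_iff, and_comm]
  simp only [this]
  congr 1
  rw [Finset.sum_const, Finset.card_range, nsmul_eq_mul, inv_mul_cancel_left₀ hM',
    RCLike.conj_mul, ha]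
  push_cast
  rfl

theorem gaborSub_perturbedWindow (hM : 0 < M) {K : ℕ} (hK : K ≤ M) (c : ℕ → ℂ) (i : Fin N)
    (p : ℤ × ℤ) : gaborSub N a (perturbedWindow d M K c) i p = gaborSub N a (step 0 1 d) i p +
      modulation (a * (N * p.1 + (i : ℕ)))
        (translation (p.2 + 1 : ℤ) (cellSum M (perturbationCoeff K c))) := by
  rw [gaborSub, gaborSub, perturbedWindow_eq d hM hK, map_add, map_add,
    translation_translation_cellSum hM]

theorem sum_conj_mul_perturbationCoeff {K : ℕ} (hK : K ≤ M) {c : ℕ → ℂ}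
    (hc : ∑ i ∈ Finset.Icc 1 K, c i = 0) :
    ∑ j ∈ Finset.range M, conj d * perturbationCoeff K c j = 0 := by
  rw [sum_range_perturbationCoeff hK c (fun _ z => conj d * z) (by simp), ← Finset.mul_sum,
    ← sum_Icc_one_eq_sum_range K c, hc, mul_zero]

/-- The coefficients of `g` are constant, so the inner product is either 0 or a multiple of `∑ c_i =
0`. -/
theorem inner_gaborSub_step_perturbation (hM : 0 < M) (haN : a * N = M) {K : ℕ} (hK : K ≤ M)
    {c : ℕ → ℂ} (hc : ∑ i ∈ Finset.Icc 1 K, c i = 0) (i : Fin N) (p : ℤ × ℤ) (m n : ℤ) :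
    ⟪gaborSub N a (step 0 1 d) i p, modulation (a * (N * m + (i : ℕ)))
      (translation n (cellSum M (perturbationCoeff K c)))⟫_ℂ = 0 := by
  rw [gaborSub, step_zero_one_eq_cellSum hM, inner_gabor_cellSum hM haN,
    sum_conj_mul_perturbationCoeff hK hc, mul_zero, ite_self]

theorem exists_inner_perturbation (hM : 0 < M) (haN : a * N = M) {K : ℕ} (hK : K ≤ M)
    {c : ℕ → ℂ} (hc : ∃ i ∈ Finset.Icc 1 K, c i ≠ 0) :
    ∃ s : ℝ, 0 < s ∧ ∀ (i : ℕ) (m n m' n' : ℤ),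
      ⟪modulation (a * (N * m + i)) (translation n (cellSum M (perturbationCoeff K c))),
        modulation (a * (N * m' + i)) (translation n' (cellSum M (perturbationCoeff K c)))⟫_ℂ =
      if n = n' ∧ m = m' then (s : ℂ) else 0 := by
  have hM' : (0 : ℝ) < M := by exact_mod_cast hM
  -- This is the squared norm of the perturbation.
  refine ⟨(M : ℝ)⁻¹ * ∑ j ∈ Finset.range K, ‖c (j + 1)‖ ^ 2, ?_, fun i m n m' n' => ?_⟩
  · refine mul_pos (inv_pos.2 hM') (Finset.sum_pos' (fun _ _ => by positivity) ?_)
    obtain ⟨i, hi, hci⟩ := hc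
    rw [Finset.mem_Icc] at hi
    refine ⟨i - 1, Finset.mem_range.2 (by omega), ?_⟩
    rw [Nat.sub_add_cancel hi.1]
    have := norm_pos_iff.2 hci
    positivity
  · rw [inner_gabor_cellSum hM haN,
      sum_range_perturbationCoeff hK c (fun _ z => conj z * z) (by simp)]
    congr 1
    push_cast
    congr 1
    exact Finset.sum_congr rfl fun j _ => RCLike.conj_mul _

theorem exists_isEquinormOrthogonal_gaborSub_perturbedWindow (hM : 0 < M) (haN : a * N = M)
    (ha : a = ‖d‖ ^ 2) (ha0 : 0 < a) {K : ℕ} (hK : K ≤ M) {c : ℕ → ℂ}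
    (hc : ∃ i ∈ Finset.Icc 1 K, c i ≠ 0) (hsum : ∑ i ∈ Finset.Icc 1 K, c i = 0) :
    ∃ s : ℝ, ∀ i : Fin N, IsEquinormOrthogonal (gaborSub N a (perturbedWindow d M K c) i) s := by
  obtain ⟨s, hs, hr⟩ := exists_inner_perturbation hM haN hK hc
  -- Pythagoras: the cross terms vanish, leaving the squared norms of `g` and of the perturbation.
  refine ⟨a + s, fun i => ?_⟩
  refine isEquinormOrthogonal_of_inner (by positivity) fun p q => ?_
  have hz := inner_gaborSub_step_perturbation (d := d) hM haN hK hsum i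
  have hz' : ∀ (q : ℤ × ℤ) (m n : ℤ), ⟪modulation (a * (N * m + (i : ℕ)))
      (translation n (cellSum M (perturbationCoeff K c))), gaborSub N a (step 0 1 d) i q⟫_ℂ = 0 :=
    fun q m n => inner_eq_zero_symm.1 (hz q m n)
  rw [gaborSub_perturbedWindow hM hK, gaborSub_perturbedWindow hM hK, inner_add_left,
    inner_add_right, inner_add_right, hz, hz', hr, add_zero, zero_add,
    inner_gaborSub_step hM haN ha]
  have : p = q ↔ p.2 + 1 = q.2 + 1 ∧ p.1 = q.1 := by
    rw [Prod.ext_iff, and_comm, add_left_inj]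
  simp only [← this]
  split_ifs
  · push_cast
    rfl
  · rw [add_zero]

/-- If the spaces agreed, the difference of corresponding generators would lie in `W_i`; but this
difference is a modulated translate of the perturbation, nonzero and orthogonal to `W_i`. -/
theorem gaborSpace_perturbedWindow_ne (hM : 0 < M) (haN : a * N = M) {K : ℕ} (hK : K ≤ M)
    {c : ℕ → ℂ} (hc : ∃ i ∈ Finset.Icc 1 K, c i ≠ 0) (hsum : ∑ i ∈ Finset.Icc 1 K, c i = 0)
    (i : Fin N) :
    gaborSpace N a (perturbedWindow d M K c) i ≠ gaborSpace N a (step 0 1 d) i := by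
  intro heq
  obtain ⟨s, hs, hr⟩ := exists_inner_perturbation hM haN hK hc
  set x := modulation (a * (N * (0 : ℤ) + (i : ℕ)))
    (translation (0 + 1 : ℤ) (cellSum M (perturbationCoeff K c))) with hx
  have hmem : ∀ (w : L2) (p : ℤ × ℤ), gaborSub N a w i p ∈ gaborSpace N a w i := fun w p =>
    Submodule.le_topologicalClosure _ (Submodule.subset_span ⟨p, rfl⟩)
  have hxW : x ∈ gaborSpace N a (step 0 1 d) i := by
    have h1 := hmem (perturbedWindow d M K c) (0, 0)
    rw [heq, gaborSub_perturbedWindow hM hK] at h1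
    exact (Submodule.add_mem_iff_right _ (hmem (step 0 1 d) (0, 0))).1 h1
  have hxo : x ∈ (gaborSpace N a (step 0 1 d) i)ᗮ := by
    rw [gaborSpace, Submodule.orthogonal_closure, Submodule.mem_orthogonal]
    intro w hw
    induction hw using Submodule.span_induction with
    | mem w hw =>
      obtain ⟨p, rfl⟩ := hw
      exact inner_gaborSub_step_perturbation hM haN hK hsum i p _ _
    | zero => simp
    | add x y _ _ hx hy => rw [inner_add_left, hx, hy, add_zero]
    | smul c x _ hx => rw [inner_smul_left, hx, mul_zero]
  have h2 := hr i 0 (0 + 1) 0 (0 + 1)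
  rw [if_pos ⟨rfl, rfl⟩, ← hx, Submodule.inner_right_of_mem_orthogonal hxW hxo] at h2
  exact hs.ne (by exact_mod_cast h2)

end Orthogonality

section Modulation

theorem modulation_modulation (a b : ℝ) (f : L2) :
    modulation a (modulation b f) = modulation (a + b) f := by
  apply Lp.ext
  filter_upwards [coeFn_modulation a (modulation b f), coeFn_modulation b f,
    coeFn_modulation (a + b) f] with x h1 h2 h3
  rw [h1, h2, h3, ← mul_assoc, character_mul_character]

theorem map_topologicalClosure_span {H : Type*} [NormedAddCommGroup H] [InnerProductSpace ℂ H]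
    (U : H ≃ₗᵢ[ℂ] H) (s : Set H) :
    (Submodule.span ℂ s).topologicalClosure.map (U.toLinearEquiv : H →ₗ[ℂ] H) =
      (Submodule.span ℂ (U '' s)).topologicalClosure := by
  apply SetLike.coe_injective
  have h1 : (Submodule.span ℂ (U '' s) : Set H) = U '' (Submodule.span ℂ s : Set H) := by
    have := Submodule.map_span (U.toLinearEquiv : H →ₗ[ℂ] H) s
    exact (congrArg (fun S : Submodule ℂ H => (S : Set H)) this).symm
  rw [Submodule.topologicalClosure_coe, h1]
  exact U.toHomeomorph.image_closure _

theorem gaborSpace_finRotate (N : ℕ) (a : ℝ) (g : L2) (i : Fin N) :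
    gaborSpace N a g (finRotate N i) =
      (gaborSpace N a g i).map ((modulation a).toLinearEquiv : L2 →ₗ[ℂ] L2) := by
  rw [gaborSpace, gaborSpace, map_topologicalClosure_span]
  congr 2
  rw [← range_comp]
  obtain ⟨N, rfl⟩ : ∃ k, N = k + 1 := ⟨N - 1, by have := i.pos; omega⟩
  have key : ∀ p, modulation a (gaborSub (N + 1) a g i p) =
      modulation (a * ((N + 1 : ℕ) * p.1 + ((i : ℕ) + 1))) (translation p.2 g) := by
    intro p
    rw [gaborSub, modulation_modulation]
    congr 2
    ring
  -- At the last index the frequency gains a full `aN`, which is absorbed by the shift of `m` by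
  -- one; this permutes the generators.
  by_cases hi : i = Fin.last N
  · have h2 : (fun p => modulation a (gaborSub (N + 1) a g i p)) =
        gaborSub (N + 1) a g (finRotate (N + 1) i) ∘
          (Equiv.prodCongr (Equiv.addRight (1 : ℤ)) (Equiv.refl ℤ)) := by
      funext p
      rw [key]
      simp only [hi, finRotate_last, Function.comp_apply, gaborSub, Equiv.prodCongr_apply,
        Prod.map, Equiv.coe_addRight, Equiv.refl_apply, Fin.val_last, Fin.val_zero]
      congr 2
      push_cast
      ring
    change _ = range (fun p => modulation a (gaborSub (N + 1) a g i p))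
    rw [h2, EquivLike.range_comp]
  · congr 1
    funext p
    rw [Function.comp_apply, key, gaborSub, coe_finRotate_of_ne_last hi]
    push_cast
    rfl

end Modulation

end GaborSpaces

end FusionFrame

namespace FusionFrame

/-! ### From Gabor identities to fusion frames -/

section FusionFrames

open scoped InnerProductSpace ComplexConjugate
open Set

variable {N : ℕ} {a : ℝ} {g h : L2}

/-- Regrouped by residues, the Parseval sum is `∑_i a ‖π_{W_i} f‖²`. -/
theorem isTightFusionFrame_gaborSpace [NeZero N] (hpars : IsParsevalFrame (gabor a g))
    (ha0 : 0 < a) (hg : ∀ i : Fin N, IsEquinormOrthogonal (gaborSub N a g i) a) :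
    IsTightFusionFrame (gaborSpace N a g) (fun _ => 1) a⁻¹ := by
  refine ⟨fun _ => one_pos, inv_pos.2 ha0, fun f => ?_⟩
  have h1 := ((residueEquiv N).hasSum_iff.2 (hpars f)).prod_fiberwise
    (g := fun i => a * ‖(gaborSpace N a g i).orthogonalProjectionOnto f‖ ^ 2) fun i => by
      simp only [Function.comp_apply, gabor_residueEquiv]
      exact (hg i).hasSum_sq_norm_inner f
  have h2 := h1.unique (hasSum_fintype _)
  simp only [one_pow, one_mul]
  rw [h2, ← Finset.mul_sum, inv_mul_cancel_left₀ ha0.ne']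

theorem summable_sq_norm_inner_gabor [NeZero N] {s : ℝ}
    (hh : ∀ i : Fin N, IsEquinormOrthogonal (gaborSub N a h i) s) (u : L2) :
    Summable fun p => ‖⟪gabor a h p, u⟫_ℂ‖ ^ 2 := by
  rw [← (residueEquiv N).summable_iff]
  refine (summable_prod_of_nonneg fun _ => sq_nonneg _).2 ⟨fun i => ?_, .of_finite⟩
  simp only [gabor_residueEquiv]
  exact ((hh i).hasSum_sq_norm_inner u).summable

theorem exists_isQDualFusionFrame_gaborSpace [NeZero N] {s : ℝ} (ha0 : 0 < a)
    (hpars : IsParsevalFrame (gabor a g))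
    (hg : ∀ i : Fin N, IsEquinormOrthogonal (gaborSub N a g i) a)
    (hh : ∀ i : Fin N, IsEquinormOrthogonal (gaborSub N a h i) s)
    (hdual : ∀ f u : L2,
      HasSum (fun p => conj ⟪gabor a g p, f⟫_ℂ * ⟪gabor a h p, u⟫_ℂ) ⟪f, u⟫_ℂ) :
    ∃ Q : DirSum (gaborSpace N a g) →L[ℂ] DirSum (gaborSpace N a h),
      IsQDualFusionFrame (gaborSpace N a h) (fun _ => 1) (gaborSpace N a g) (fun _ => 1) Q ∧
      ∀ (F : DirSum (gaborSpace N a g)) (i : Fin N),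
        HasSum (fun p : ℤ × ℤ => ⟪gaborSub N a g i p, (F i : L2)⟫_ℂ • gaborSub N a h i p)
          ((Q F i : gaborSpace N a h i) : L2) := by
  have hex : ∀ i : Fin N, ∃ q : L2 →L[ℂ] gaborSpace N a h i,
      ∀ f, HasSum (fun p => ⟪gaborSub N a g i p, f⟫_ℂ • gaborSub N a h i p) (q f : L2) :=
    fun i => (hg i).exists_frameOperator (hh i)
  choose q hq using hex
  let Q : DirSum (gaborSpace N a g) →L[ℂ] DirSum (gaborSpace N a h) :=
    (PiLp.continuousLinearEquiv 2 ℂ (fun i => gaborSpace N a h i)).symm.toContinuousLinearMap ∘L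
      ContinuousLinearMap.pi fun i => q i ∘L (gaborSpace N a g i).subtypeL ∘L
        PiLp.proj 2 (𝕜 := ℂ) (fun i => gaborSpace N a g i) i
  have hQ : ∀ (F : DirSum (gaborSpace N a g)) (i : Fin N), Q F i = q i (F i : L2) :=
    fun F i => rfl
  -- The generators lie in `W_i`, so projecting `f` first does not change its coefficients.
  have hproj : ∀ (f : L2) (i : Fin N) (p : ℤ × ℤ),
      ⟪gaborSub N a g i p, ((gaborSpace N a g i).orthogonalProjectionOnto f : L2)⟫_ℂ =
        ⟪gaborSub N a g i p, f⟫_ℂ := fun f i p =>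
    Submodule.inner_orthogonalProjectionOnto_eq_of_mem_left
      (⟨_, Submodule.le_topologicalClosure _ (Submodule.subset_span ⟨p, rfl⟩)⟩ :
        gaborSpace N a g i) f
  have hid : synthesis (gaborSpace N a h) (fun _ => 1) ∘L Q ∘L
      analysis (gaborSpace N a g) (fun _ => 1) = ContinuousLinearMap.id ℂ L2 := by
    ext1 f
    -- Tested against `u`, the operator identity becomes the scalar dual sum regrouped by residues.
    refine ext_inner_right ℂ fun u => ?_
    rw [ContinuousLinearMap.comp_apply, ContinuousLinearMap.comp_apply, synthesis_one_apply,
      sum_inner, ContinuousLinearMap.id_apply]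
    have h1 := ((residueEquiv N).hasSum_iff.2 (hdual f u)).prod_fiberwise
      (g := fun i => ⟪(Q (analysis (gaborSpace N a g) (fun _ => 1) f) i : L2), u⟫_ℂ) fun i => by
        simp only [Function.comp_apply, gabor_residueEquiv]
        rw [hQ, analysis_one_apply]
        have h2 := ((hq i ((gaborSpace N a g i).orthogonalProjectionOnto f)).mapL
          (innerSL ℂ u)).star
        simp only [innerSL_apply_apply, hproj, inner_smul_right, star_mul', RCLike.star_def,
          inner_conj_symm] at h2
        simp only [inner_conj_symm]
        exact h2
    exact (hasSum_fintype _).unique h1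
  exact ⟨Q, ⟨(isTightFusionFrame_gaborSpace hpars ha0 hg).isFusionFrame,
    isFusionFrame_of_dual _ Q hid, hid⟩, fun F i => hq i (F i)⟩

end FusionFrames

end FusionFrame

theorem mainTheorem8 (d : ℂ) (N M : ℕ) (c : ℕ → ℂ)
    (hd : 1 / Real.sqrt 2 < ‖d‖) (hd1 : ‖d‖ < 1)
    (hM : ‖d‖ ^ 2 * (N : ℝ) = (M : ℝ)) (hM1 : 1 < M)
    (hc : ∃ i ∈ Finset.Icc 1 (N - M), c i ≠ 0)
    (hsum : ∑ i ∈ Finset.Icc 1 (N - M), c i = 0)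
    (a : ℝ) (ha : a = ‖d‖ ^ 2)
    (g h : FusionFrame.L2) (hg : g = FusionFrame.step 0 1 d)
    (hh : h = FusionFrame.perturbedWindow d M (N - M) c) :
    -- the Gabor system of `g` is a Parseval frame
    FusionFrame.IsParsevalFrame (FusionFrame.gabor a g) ∧
    -- both families are harmonic fusion frames, and that of `g` is tight
    FusionFrame.IsHarmonicFusionFrame (FusionFrame.modulation a) (FusionFrame.gaborSpace N a g) ∧
    FusionFrame.IsTightFusionFrame (FusionFrame.gaborSpace N a g) (fun _ => 1) a⁻¹ ∧
    FusionFrame.IsHarmonicFusionFrame (FusionFrame.modulation a) (FusionFrame.gaborSpace N a h) ∧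
    -- the family of `h` is a dual fusion frame of the family of `g`
    FusionFrame.IsDualFusionFrame (FusionFrame.gaborSpace N a h) (fun _ => 1)
      (FusionFrame.gaborSpace N a g) (fun _ => 1) ∧
    -- more precisely, it is the `Q`-dual for the operator `Q` given by the two Gabor systems
    (∃ Q : FusionFrame.DirSum (FusionFrame.gaborSpace N a g) →L[ℂ]
        FusionFrame.DirSum (FusionFrame.gaborSpace N a h),
      FusionFrame.IsQDualFusionFrame (FusionFrame.gaborSpace N a h) (fun _ => 1)
        (FusionFrame.gaborSpace N a g) (fun _ => 1) Q ∧
      ∀ (F : FusionFrame.DirSum (FusionFrame.gaborSpace N a g)) (i : Fin N),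
        HasSum (fun p : ℤ × ℤ =>
          (inner ℂ (FusionFrame.gaborSub N a g i p) (F i : FusionFrame.L2)) •
            FusionFrame.gaborSub N a h i p)
          ((Q F i : FusionFrame.gaborSpace N a h i) : FusionFrame.L2)) ∧
    -- the family of `g` is its own canonical dual, and that of `h` differs from it at every index
    FusionFrame.canonicalDual (FusionFrame.gaborSpace N a g) (fun _ => 1) =
      FusionFrame.gaborSpace N a g ∧
    (∀ i, FusionFrame.gaborSpace N a h i ≠ FusionFrame.gaborSpace N a g i) ∧
    (∀ i, FusionFrame.gaborSpace N a h i ≠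
      FusionFrame.canonicalDual (FusionFrame.gaborSpace N a g) (fun _ => 1) i) := by
  have hMpos : 0 < M := by omega
  have hMr : (0 : ℝ) < M := by exact_mod_cast hMpos
  have hd0 : 0 < ‖d‖ := lt_trans (by positivity) hd
  have ha0 : 0 < a := by rw [ha]; positivity
  have ha1 : a < 1 := by rw [ha]; nlinarith
  have haN : a * N = M := by rw [ha, hM]
  -- The bound `|d| > 1/√2` serves to give `N < 2M`, so that the `N - M` perturbed cells fit in one
  -- unit interval.
  have ha2 : 1 / 2 < a := by
    have h1 : (1 / Real.sqrt 2) ^ 2 < ‖d‖ ^ 2 := pow_lt_pow_left₀ hd (by positivity) two_ne_zero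
    rwa [div_pow, one_pow, Real.sq_sqrt zero_le_two, ← ha] at h1
  have hNr : (0 : ℝ) < N := by
    by_contra hN
    have : a * N ≤ 0 := mul_nonpos_of_nonneg_of_nonpos ha0.le (not_lt.1 hN)
    linarith
  have hMN : M ≤ N := by
    have : (M : ℝ) ≤ N := by rw [← haN]; nlinarith
    exact_mod_cast this
  have hN2 : N < 2 * M := by
    have : (N : ℝ) < 2 * M := by rw [← haN]; nlinarith
    exact_mod_cast this
  have hK : N - M ≤ M := by omega
  have : NeZero N := ⟨by omega⟩
  -- The support of `h` is contained in exactly one period of the characters `E_{am}`.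
  have hainv : 1 + ((N - M : ℕ) : ℝ) / M = a⁻¹ := by
    rw [Nat.cast_sub hMN, ← haN]
    field_simp
    ring
  subst hg hh
  obtain ⟨ψ, D, hψ, hψm, hD, hψ0, hψ1⟩ :=
    FusionFrame.exists_coeFn_perturbedWindow d (K := N - M) hMpos c
  rw [hainv] at hψ0
  have hgo : ∀ i : Fin N, FusionFrame.IsEquinormOrthogonal
      (FusionFrame.gaborSub N a (FusionFrame.step 0 1 d) i) a := fun i =>
    FusionFrame.isEquinormOrthogonal_of_inner ha0
      (FusionFrame.inner_gaborSub_step hMpos haN ha i)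
  obtain ⟨s, hho⟩ := FusionFrame.exists_isEquinormOrthogonal_gaborSub_perturbedWindow (N := N)
    hMpos haN ha ha0 hK hc hsum
  have hpars := FusionFrame.isParsevalFrame_gabor ha0 ha1 ha (FusionFrame.coeFn_step 0 1 d)
  have htight := FusionFrame.isTightFusionFrame_gaborSpace hpars ha0 hgo
  have hQ := FusionFrame.exists_isQDualFusionFrame_gaborSpace ha0 hpars hgo hho fun f u =>
    FusionFrame.hasSum_conj_inner_gabor_mul ha0 ha1 ha (FusionFrame.coeFn_step 0 1 d) hψ hψm hD
      hψ0 hψ1 f u (FusionFrame.summable_sq_norm_inner_gabor hho u)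
  have hne := FusionFrame.gaborSpace_perturbedWindow_ne (d := d) hMpos haN hK hc hsum
  have hcan := FusionFrame.canonicalDual_eq_self _ htight
  obtain ⟨Q, hQd, hQs⟩ := hQ
  refine ⟨hpars, ⟨htight.isFusionFrame, FusionFrame.gaborSpace_finRotate N a _⟩, htight,
    ⟨hQd.2.1, FusionFrame.gaborSpace_finRotate N a _⟩, ⟨Q, hQd⟩, ⟨Q, hQd, hQs⟩, hcan, hne, ?_⟩
  rw [hcan]
  exact hne
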